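/- Let $\mathbb F$ be a finite field, $n\ge 1$, $0\le d\le n$. For $\ell\ge 1$ and $x=(x_1,\dots,x_\ell)\in(\mathbb F^n)^\ell$, let the configuration of $x$ be the function $\mathbb F^\ell\to\{0,\dots,n\}$, $k\mapsto\bigl|\sum_{i=1}^\ell k_ix_i\bigr|$, where $|z|$ is the number of nonzero coordinates of $z$. Put $X=(\mathbb F^n)^\ell$ and let $R$ be the partition of $X\times X$ in which $(x,y)$ and $(x',y')$ lie in the same class if and only if $x-y$ and $x'-y'$ have the same configuration; $(X,R)$ is a commutative association scheme (the $\mathbb F^\ell$-refined $\ell$th tensor power of the Hamming scheme on $\mathbb F^n$). Let $(E_s)_{s\in R'}$ be the primitive idempotents of its Bose--Mesner algebra, that is, of the complex matrix algebra generated by the adjacency matrices $D_r$ ($r\in R$), and write $E_s=\sum_{r\in R}q_s(r)D_r$. Let $\mathrm{KrawtchoukLP}^{\mathbb F}_{\mathrm{Lin}}(n,d,\ell)$ be the Delsarte linear program $$\max\ \sum_{r\in R}a_r$$ over real variables $(a_r)_{r\in R}$, subject to $a_{r}=1$ for the diagonal relation $r=\{(x,x)\mid x\in X\}$; $a_r=0$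 whenever the configuration of $x-y$, for $(x,y)\in r$, takes a value in $\{1,\dots,d-1\}$; $\sum_{r\in R}q_s(r)a_r\in\mathbb R_{\ge 0}$ for all $s\in R'$; and $a_r\ge 0$ for all $r\in R$. Then this maximum exists for every $\ell\ge 1$; denote it by $\mathsf{val}(\mathrm{KrawtchoukLP}^{\mathbb F}_{\mathrm{Lin}}(n,d,\ell))$. For all $\ell_1,\ell_2\ge 1$, $$\mathsf{val}(\mathrm{KrawtchoukLP}^{\mathbb F}_{\mathrm{Lin}}(n,d,\ell_1+\ell_2))\le \mathsf{val}(\mathrm{KrawtchoukLP}^{\mathbb F}_{\mathrm{Lin}}(n,d,\ell_1))\cdot \mathsf{val}(\mathrm{KrawtchoukLP}^{\mathbb F}_{\mathrm{Lin}}(n,d,\ell_2)),$$ and hence $$\log\mathsf{val}(\mathrm{KrawtchoukLP}^{\mathbb F}_{\mathrm{Lin}}(n,d,\ell_1+\ell_2))\le \log\mathsf{val}(\mathrm{KrawtchoukLP}^{\mathbb F}_{\mathrm{Lin}}(n,d,\ell_1))+\log \mathsf{val}(\mathrm{KrawtchoukLP}^{\mathbb F}_{\mathrm{Lin}}(n,d,\ell_2)).$$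 -/

import Mathlib

/-! A finite set `X` with a partition of `X × X` into nonempty relations is given by a setoid `S`
on `X × X`; the relations are the classes, that is, the elements of `Quotient S`. -/

namespace AssocScheme

section Delsarte

variable {X : Type*} [Fintype X] [DecidableEq X]

open Classical in
/-- The adjacency matrix `D_r` of the relation `r`. -/
noncomputable def adjMatrix (S : Setoid (X × X)) (r : Quotient S) : Matrix X X ℂ :=
  Matrix.of fun x y => if (Quotient.mk S (x, y)) = r then 1 else 0

/-- The Bose--Mesner algebra: the complex algebra generated by the adjacency matrices. -/
noncomputable def boseMesner (S : Setoid (X × X)) : Subalgebra ℂ (Matrix X X ℂ) :=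
  Algebra.adjoin ℂ (Set.range (adjMatrix S))

/-- `E` is a primitive (nonzero, minimal) idempotent of the Bose--Mesner algebra. For a commutative
association scheme these are exactly the members `E_s` of the unique basis of the Bose--Mesner
algebra that consists of pairwise orthogonal idempotents. -/
structure IsPrimitiveIdempotent (S : Setoid (X × X)) (E : Matrix X X ℂ) : Prop where
  mem : E ∈ boseMesner S
  ne_zero : E ≠ 0
  mul_self : E * E = E
  minimal : ∀ e ∈ boseMesner S, e * e = e → e * E = e → E * e = e → e = 0 ∨ e = E

/-- The `q`-function of a matrix `E` of the Bose--Mesner algebra: the common value of the entries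
of `E` on the relation `r`, which is the coefficient of `D_r` in `E` (see `qFun_unique`). -/
noncomputable def qFun (S : Setoid (X × X)) (E : Matrix X X ℂ) (r : Quotient S) : ℂ :=
  E r.out.1 r.out.2

open Classical in
/-- If `E` is a combination of adjacency matrices, its coefficients are given by `qFun`. -/
theorem qFun_unique {Y : Type*} [Fintype Y] (S : Setoid (Y × Y)) (E : Matrix Y Y ℂ)
    (q : Quotient S → ℂ) (h : E = ∑ r, q r • adjMatrix S r) : qFun S E = q := by
  funext r
  have h2 : Quotient.mk S (r.out.1, r.out.2) = r := Quotient.out_eq r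
  simp [qFun, h, Matrix.sum_apply, adjMatrix, h2]

open Classical in
/-- Feasible solutions `(a_r)` of the Delsarte linear program of `S` and a set `D` of relations. -/
structure DelsarteFeasible (S : Setoid (X × X)) (D : Set (Quotient S))
    (a : Quotient S → ℝ) : Prop where
  normalization : ∀ x : X, a (Quotient.mk S (x, x)) = 1
  code : ∀ r, r ∉ D → a r = 0
  macWilliams : ∀ E, IsPrimitiveIdempotent S E →
    ∃ t : ℝ, 0 ≤ t ∧ ∑ r, qFun S E r * (a r : ℂ) = (t : ℂ)
  nonneg : ∀ r, 0 ≤ a r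

open Classical in
/-- The objective values of the feasible solutions of the Delsarte linear program. -/
def delsarteObjectives (S : Setoid (X × X)) (D : Set (Quotient S)) : Set ℝ :=
  {v | ∃ a : Quotient S → ℝ, DelsarteFeasible S D a ∧ v = ∑ r, a r}

/-- The value of the Delsarte linear program. -/
noncomputable def delsarteVal (S : Setoid (X × X)) (D : Set (Quotient S)) : ℝ :=
  sSup (delsarteObjectives S D)

end Delsarte

section Refinement

variable {K X : Type*} [Ring K] [AddCommGroup X] [Module K X]

/-- For a translation-invariant `S`, the function `f_S` with `(x, y) ∈ f_S (x - y)`. -/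
def translationMap (S : Setoid (X × X)) (x : X) : Quotient S :=
  Quotient.mk S (x, 0)

/-- The function `f_{S,T}`, which records `f_S` on the linear combinations with coefficients
in `T`. -/
def configuration (S : Setoid (X × X)) {l : ℕ} (T : Set (Fin l → K)) (x : Fin l → X)
    (k : T) : Quotient S :=
  translationMap S (∑ i, k.1 i • x i)

/-- The `T`-refined `l`-th tensor power: `(x, y)` and `(x', y')` are in the same relation if
and only if `x - y` and `x' - y'` have the same configuration. -/
def refinedPower (S : Setoid (X × X)) {l : ℕ} (T : Set (Fin l → K)) :
    Setoid ((Fin l → X) × (Fin l → X)) :=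
  Setoid.ker fun p => configuration S T (p.1 - p.2)

/-- The relations of the `T`-refined tensor power whose configuration takes all its values
in `D`. -/
def refinedCode (S : Setoid (X × X)) {l : ℕ} (T : Set (Fin l → K)) (D : Set (Quotient S)) :
    Set (Quotient (refinedPower S T)) :=
  {r | ∃ x y : Fin l → X, r = Quotient.mk (refinedPower S T) (x, y) ∧
    ∀ k : T, configuration S T (x - y) k ∈ D}

end Refinement

section Hamming

variable (F : Type*) [Field F] [Fintype F] [DecidableEq F]

/-- The weak Hamming scheme of order `n` over `F`: the relation of `(x, y)` is determined by the
Hamming distance. -/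
def weakHamming (n : ℕ) : Setoid ((Fin n → F) × (Fin n → F)) :=
  Setoid.ker fun p => hammingDist p.1 p.2

/-- The set `{r_0, r_d, r_{d+1}, …, r_n}`, where `r_i` is the relation of Hamming distance `i`. -/
def distanceCode (n d : ℕ) : Set (Quotient (weakHamming F n)) :=
  {r | ∃ x y : Fin n → F, r = Quotient.mk (weakHamming F n) (x, y) ∧
    (hammingDist x y = 0 ∨ d ≤ hammingDist x y)}

/-- The objective values of the feasible solutions of the level-`l` program for linear codes. -/
def krawtchoukLinObjectives (n d l : ℕ) : Set ℝ :=
  delsarteObjectives (refinedPower (weakHamming F n) (Set.univ : Set (Fin l → F)))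
    (refinedCode (weakHamming F n) (Set.univ : Set (Fin l → F)) (distanceCode F n d))

/-- The value of the level-`l` program for linear codes: the Delsarte linear program of the
`F^l`-refined `l`-th tensor power of the weak Hamming scheme. -/
noncomputable def krawtchoukLinVal (n d l : ℕ) : ℝ :=
  delsarteVal (refinedPower (weakHamming F n) (Set.univ : Set (Fin l → F)))
    (refinedCode (weakHamming F n) (Set.univ : Set (Fin l → F)) (distanceCode F n d))

end Hamming

end AssocScheme

/-! The linear program is traded for a semidefinite one in which the product structure is visible.
Its objective values are the numbers `|X|⁻¹ ∑ N x y`, where `N` is entrywise nonnegative, positive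
semidefinite, supported on the allowed relations and of trace `|X|`
(`DelsarteFeasible.exists_isDelsarteMatrix`, `IsDelsarteMatrix.mem_delsarteObjectives`). The
translation works because the relations are orbitals of a permutation group: by MacWilliams'
extension theorem, tuples with equal configurations differ by a monomial transformation
(`isSchurian_refinedPower`). Hence the Bose–Mesner algebra consists of the class-constant matrices,
and the MacWilliams inequalities express positive semidefiniteness.

For submultiplicativity, take an optimal `N` on `X₁ × X₂` with unit diagonal. Each diagonal block
`{x} × X₂` is admissible for the second program, so its entries sum to at most `|X₂| v₂`. Replacing
every block by its entry sum gives a matrix `C` on `X₁`, admissible up to scale for the first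
program, with trace at most `|X₁| |X₂| v₂`. Its entry sum is that of `N`, namely `|X₁| |X₂| v`, and
is at most `v₁` times its trace. Hence `v ≤ v₁ v₂` (`delsarteVal_le_mul`). -/

namespace AssocScheme

/-! ### MacWilliams' extension theorem over a finite field. -/

section Extension

open Module

theorem exists_perm_comp_eq_of_card_fiber_eq {ι Ω : Type*} [Fintype ι] [DecidableEq Ω]
    (P Q : ι → Ω)
    (h : ∀ ω, Fintype.card {j // P j = ω} = Fintype.card {j // Q j = ω}) :
    ∃ σ : Equiv.Perm ι, ∀ j, P (σ j) = Q j := by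
  let e : ∀ ω, {j // Q j = ω} ≃ {j // P j = ω} := fun ω => Fintype.equivOfCardEq (h ω).symm
  refine ⟨(Equiv.sigmaFiberEquiv Q).symm.trans
    ((Equiv.sigmaCongrRight e).trans (Equiv.sigmaFiberEquiv P)), fun j => ?_⟩
  exact (e (Q j) ⟨j, rfl⟩).2

variable {F W : Type*} [Field F] [AddCommGroup W] [Module F W]

theorem mem_span_singleton_of_ker_le (y g : Dual F W)
    (h : ∀ k, y k = 0 → g k = 0) : g ∈ Submodule.span F {y} := by
  have := mem_span_of_iInf_ker_le_ker (ι := Unit) (L := fun _ => y) (K := g)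
    (by intro k hk; simp at hk ⊢; exact h k hk)
  simpa using this

variable [Finite F] [Finite W]

theorem natCard_ne_zero_of_ne_zero (g : Dual F W) (hg : g ≠ 0) :
    Nat.card {k : W // g k ≠ 0} = Nat.card W - Nat.card W / Nat.card F := by
  classical
  have : Fintype W := Fintype.ofFinite W
  have h1 : Nat.card W = Nat.card (LinearMap.ker g) * Nat.card F := by
    rw [Module.natCard_eq_pow_finrank (K := F) (V := W),
      Module.natCard_eq_pow_finrank (K := F) (V := LinearMap.ker g),
      ← Dual.finrank_ker_add_one_of_ne_zero hg, pow_succ]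
  have h2 : Nat.card W / Nat.card F = Nat.card (LinearMap.ker g) := by
    rw [h1, Nat.mul_div_cancel _ Nat.card_pos]
  have h3 : Nat.card {k : W // g k ≠ 0} = Nat.card W - Nat.card {k : W // g k = 0} := by
    simp only [Nat.card_eq_fintype_card]
    exact Fintype.card_subtype_compl _
  rw [h2, h3]
  rfl

/-- The weights of a family of functionals on the kernel of `y` count the members of the family
which are not multiples of `y`. -/
theorem sum_weight_ker {ι : Type*} [Fintype ι] (f : ι → Dual F W) (y : Dual F W)
    [Fintype (LinearMap.ker y)] :
    ∑ k : LinearMap.ker y, Nat.card {j // f j k ≠ 0} =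
      Nat.card {j // f j ∉ Submodule.span F {y}} *
        (Nat.card (LinearMap.ker y) - Nat.card (LinearMap.ker y) / Nat.card F) := by
  classical
  have key : ∀ j, Nat.card {k : LinearMap.ker y // f j k ≠ 0} =
      if f j ∉ Submodule.span F {y} then
        (Nat.card (LinearMap.ker y) - Nat.card (LinearMap.ker y) / Nat.card F) else 0 := by
    intro j
    by_cases hj : f j ∈ Submodule.span F {y}
    swap
    · rw [if_pos hj]
      refine natCard_ne_zero_of_ne_zero ((f j).comp (LinearMap.ker y).subtype) fun h0 => hj ?_
      refine mem_span_singleton_of_ker_le _ _ fun k hk => ?_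
      exact LinearMap.congr_fun h0 ⟨k, hk⟩
    · rw [if_neg (not_not.2 hj)]
      have : IsEmpty {k : LinearMap.ker y // f j k ≠ 0} := by
        refine ⟨fun k => k.2 ?_⟩
        obtain ⟨c, hc⟩ := Submodule.mem_span_singleton.1 hj
        have hk : y (k : LinearMap.ker y) = 0 := (k : LinearMap.ker y).2
        have := LinearMap.congr_fun hc (k : LinearMap.ker y)
        rw [← this, LinearMap.smul_apply, hk, smul_zero]
      exact Nat.card_of_isEmpty
  calc ∑ k : LinearMap.ker y, Nat.card {j // f j k ≠ 0}
      = ∑ k : LinearMap.ker y, ∑ j, if f j k ≠ 0 then 1 else 0 := by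
        simp only [Nat.card_eq_fintype_card, Fintype.card_subtype, Finset.card_filter]
    _ = ∑ j, ∑ k : LinearMap.ker y, if f j k ≠ 0 then 1 else 0 := Finset.sum_comm
    _ = ∑ j, Nat.card {k : LinearMap.ker y // f j k ≠ 0} := by
        simp only [Nat.card_eq_fintype_card, Fintype.card_subtype, Finset.card_filter]
    _ = _ := by
        simp only [key]
        rw [← Finset.sum_filter, Finset.sum_const, smul_eq_mul, ← Fintype.card_subtype,
          ← Nat.card_eq_fintype_card]

/-- The total weight on `ker y` is the number of members off the line of `y` times a constant. That
constant is positive since `|F| > 1`, so it cancels. The case `y = 0` is included and counts the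
zero functionals. -/
theorem card_mem_span_eq {ι : Type*} [Fintype ι] (f f' : ι → Dual F W)
    (h : ∀ k, Nat.card {j // f j k ≠ 0} = Nat.card {j // f' j k ≠ 0}) (y : Dual F W) :
    Nat.card {j // f j ∈ Submodule.span F {y}} = Nat.card {j // f' j ∈ Submodule.span F {y}} := by
  classical
  have : Fintype (LinearMap.ker y) := Fintype.ofFinite _
  have h1 := sum_weight_ker f y
  rw [Finset.sum_congr rfl fun (k : LinearMap.ker y) _ => h k, sum_weight_ker f' y] at h1
  have hpos : 0 < Nat.card (LinearMap.ker y) - Nat.card (LinearMap.ker y) / Nat.card F :=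
    Nat.sub_pos_of_lt (Nat.div_lt_self Nat.card_pos Finite.one_lt_card)
  have h2 := Nat.eq_of_mul_eq_mul_right hpos h1
  have hc : ∀ g : ι → Dual F W, Nat.card {j // g j ∈ Submodule.span F {y}} +
      Nat.card {j // g j ∉ Submodule.span F {y}} = Fintype.card ι := by
    intro g
    simp only [Nat.card_eq_fintype_card]
    rw [Fintype.card_subtype_compl, Nat.add_sub_of_le (Fintype.card_subtype_le _)]
  have := hc f
  have := hc f'
  omega

/-- **MacWilliams extension theorem**, in terms of families of functionals. -/
theorem exists_perm_units_of_card_ne_zero_eq {ι : Type*} [Fintype ι] (f f' : ι → Dual F W)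
    (h : ∀ k, Nat.card {j // f j k ≠ 0} = Nat.card {j // f' j k ≠ 0}) :
    ∃ (σ : Equiv.Perm ι) (u : ι → Fˣ), ∀ j, f' j = u j • f (σ j) := by
  classical
  -- The line of a nonzero `y` is the disjoint union of the `Fˣ`-orbits of `y` and `0`. Subtracting
  -- the count for `0` from the count for the line gives equal multiplicities on every orbit.
  let P : Dual F W → MulAction.orbitRel.Quotient Fˣ (Dual F W) := Quotient.mk _
  have hP : ∀ a b, P a = P b ↔ ∃ u : Fˣ, u • b = a := fun a b => by
    simp only [P]
    rw [Quotient.eq]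
    exact MulAction.orbitRel_apply.trans MulAction.mem_orbit_iff
  have hP0 : ∀ a, P a = P 0 ↔ a ∈ Submodule.span F {(0 : Dual F W)} := fun a => by
    rw [hP]
    simp [eq_comm]
  have hPy : ∀ y, y ≠ 0 → ∀ a, a ∈ Submodule.span F {y} ↔ P a = P y ∨ P a = P 0 := by
    intro y hy a
    rw [hP0, hP, Submodule.mem_span_singleton]
    constructor
    · rintro ⟨c, rfl⟩
      by_cases hc : c = 0
      · right; simp [hc]
      · left; exact ⟨Units.mk0 c hc, rfl⟩
    · rintro (⟨u, rfl⟩ | h)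
      · exact ⟨u, rfl⟩
      · refine ⟨0, ?_⟩
        simpa [eq_comm] using h
  have hcount : ∀ (g : ι → Dual F W) (y : Dual F W), y ≠ 0 →
      Nat.card {j // g j ∈ Submodule.span F {y}} =
        Fintype.card {j // P (g j) = P y} + Fintype.card {j // P (g j) = P 0} := by
    intro g y hy
    rw [Nat.card_eq_fintype_card, ← Fintype.card_subtype_or_disjoint]
    · exact Fintype.card_congr (Equiv.subtypeEquivRight fun j => hPy y hy _)
    · rw [Pi.disjoint_iff]
      intro j
      rw [Prop.disjoint_iff]
      rintro ⟨h1, h2⟩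
      rw [h1, hP0] at h2
      exact hy (by simpa using h2)
  have h0 : Fintype.card {j // P (f j) = P 0} = Fintype.card {j // P (f' j) = P 0} := by
    have := card_mem_span_eq f f' h 0
    simp only [Nat.card_eq_fintype_card] at this
    simpa only [hP0] using this
  obtain ⟨σ, hσ⟩ := exists_perm_comp_eq_of_card_fiber_eq (P ∘ f) (P ∘ f') (by
    intro ω
    induction ω using Quotient.inductionOn with
    | h y =>
      by_cases hy : y = 0
      · subst hy; exact h0
      · have h1 := card_mem_span_eq f f' h y
        rw [hcount f y hy, hcount f' y hy, h0] at h1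
        exact Nat.add_right_cancel h1)
  choose u hu using fun j => (hP _ _).1 (hσ j).symm
  exact ⟨σ, u, fun j => (hu j).symm⟩

end Extension

end AssocScheme

namespace AssocScheme

/-! ### Bose–Mesner algebras of symmetric Schurian schemes and positive semidefiniteness. -/

section Schurian

set_option linter.unusedSectionVars false

open Matrix
open scoped ComplexOrder

variable {X : Type*} [Fintype X] [DecidableEq X]

/-- The relations of `S` are the orbitals of a group of permutations of the points. -/
def IsSchurian (S : Setoid (X × X)) : Prop :=
  ∀ p q : X × X, S p q → ∃ φ : Equiv.Perm X, φ p.1 = q.1 ∧ φ p.2 = q.2 ∧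
    ∀ a b, S (φ a, φ b) (a, b)

/-- The entries of `M` depend only on the relation. -/
def IsClassConstant (S : Setoid (X × X)) (M : Matrix X X ℂ) : Prop :=
  ∀ p q : X × X, S p q → M p.1 p.2 = M q.1 q.2

variable {S : Setoid (X × X)}

theorem IsClassConstant.qFun_mk {M : Matrix X X ℂ} (hM : IsClassConstant S M) (p : X × X) :
    qFun S M (Quotient.mk S p) = M p.1 p.2 :=
  hM _ _ (Quotient.mk_out p)

open Classical in
theorem IsClassConstant.mem_boseMesner {M : Matrix X X ℂ} (hM : IsClassConstant S M) :
    M ∈ boseMesner S := by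
  have : M = ∑ r, qFun S M r • adjMatrix S r := by
    ext x y
    simp only [Matrix.sum_apply, Matrix.smul_apply, adjMatrix, Matrix.of_apply, smul_eq_mul,
      mul_ite, mul_one, mul_zero, Finset.sum_ite_eq, Finset.mem_univ, if_true]
    exact (hM.qFun_mk (x, y)).symm
  rw [this]
  exact Subalgebra.sum_mem _ fun r _ => Subalgebra.smul_mem _ (Algebra.subset_adjoin (Set.mem_range_self r)) _

/-- A permutation carrying one pair to the other reindexes the intermediate point of the product,
which replaces any use of intersection numbers. -/
theorem IsClassConstant.mul (hS : IsSchurian S) {M N : Matrix X X ℂ} (hM : IsClassConstant S M)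
    (hN : IsClassConstant S N) : IsClassConstant S (M * N) := by
  intro p q hpq
  obtain ⟨φ, h1, h2, h⟩ := hS p q hpq
  rw [Matrix.mul_apply, Matrix.mul_apply, ← Equiv.sum_comp φ fun j => M q.1 j * N j q.2]
  refine Finset.sum_congr rfl fun z _ => ?_
  rw [← h1, ← h2]
  exact congrArg₂ (· * ·) (hM _ _ (h p.1 z)).symm (hN _ _ (h z p.2)).symm

theorem IsSchurian.mk_diag_iff (hS : IsSchurian S) (x : X) (p : X × X)
    (h : S (x, x) p) : p.1 = p.2 := by
  obtain ⟨φ, h1, h2, -⟩ := hS _ _ h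
  exact h1.symm.trans h2

theorem isClassConstant_one (hS : IsSchurian S) : IsClassConstant S (1 : Matrix X X ℂ) := by
  intro p q hpq
  obtain ⟨φ, h1, h2, -⟩ := hS p q hpq
  simp only [Matrix.one_apply, ← h1, ← h2, φ.injective.eq_iff]

theorem mem_boseMesner_iff (hS : IsSchurian S) {M : Matrix X X ℂ} :
    M ∈ boseMesner S ↔ IsClassConstant S M := by
  refine ⟨fun h => ?_, IsClassConstant.mem_boseMesner⟩
  induction h using Algebra.adjoin_induction with
  | mem M hM =>
    obtain ⟨r, rfl⟩ := hM
    intro p q hpq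
    have : (Quotient.mk S p) = Quotient.mk S q := Quotient.sound hpq
    simp only [adjMatrix, Matrix.of_apply]
    rw [this]
  | algebraMap c =>
    intro p q hpq
    have := isClassConstant_one hS p q hpq
    simp only [Algebra.algebraMap_eq_smul_one, Matrix.smul_apply, this]
  | add M N _ _ hM hN =>
    intro p q hpq
    simp only [Matrix.add_apply, hM p q hpq, hN p q hpq]
  | mul M N _ _ hM hN => exact hM.mul hS hN

/-- Every relation of `S` is symmetric. -/
def IsSymmScheme (S : Setoid (X × X)) : Prop :=
  ∀ x y : X, S (x, y) (y, x)

theorem IsClassConstant.transpose_eq (hs : IsSymmScheme S) {M : Matrix X X ℂ}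
    (hM : IsClassConstant S M) : Mᵀ = M := by
  ext x y
  exact hM (y, x) (x, y) (hs y x)

theorem IsClassConstant.conjTranspose (hs : IsSymmScheme S) {M : Matrix X X ℂ}
    (hM : IsClassConstant S M) : IsClassConstant S Mᴴ := by
  intro p q hpq
  rw [conjTranspose_apply, conjTranspose_apply,
    hM (p.2, p.1) (q.2, q.1) (S.trans (hs _ _) (S.trans hpq (hs _ _)))]

/-- Transposition fixes every class-constant matrix and reverses products. -/
theorem IsClassConstant.mul_comm (hS : IsSchurian S) (hs : IsSymmScheme S)
    {M N : Matrix X X ℂ} (hM : IsClassConstant S M) (hN : IsClassConstant S N) :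
    M * N = N * M := by
  rw [← (hM.mul hS hN).transpose_eq hs, transpose_mul, hM.transpose_eq hs, hN.transpose_eq hs]

theorem IsClassConstant.isHermitian_of_idempotent (hS : IsSchurian S) (hs : IsSymmScheme S)
    {E : Matrix X X ℂ} (hE : IsClassConstant S E) (h : E * E = E) : Eᴴ = E := by
  have hE' := hE.conjTranspose hs
  have hc := hE.mul_comm hS hs hE'
  have h' : Eᴴ * Eᴴ = Eᴴ := by rw [← conjTranspose_mul, h]
  -- `E` is normal by commutativity. A matrix `A` with `Aᴴ * A = 0` vanishes, so `E = Eᴴ * E`, which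
  -- is Hermitian.
  have h0 : (E - Eᴴ * E)ᴴ * (E - Eᴴ * E) = 0 := by
    have h1 : (E - Eᴴ * E)ᴴ = Eᴴ - Eᴴ * E := by
      rw [conjTranspose_sub, conjTranspose_mul, conjTranspose_conjTranspose]
    have h2 : Eᴴ * E * E = Eᴴ * E := by rw [mul_assoc, h]
    have h3 : Eᴴ * (Eᴴ * E) = Eᴴ * E := by rw [← mul_assoc, h']
    have h4 : Eᴴ * E * (Eᴴ * E) = Eᴴ * E := by
      rw [← mul_assoc, mul_assoc Eᴴ E Eᴴ, hc, h3, h2]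
    rw [h1, sub_mul, mul_sub, mul_sub, h2, h3, h4, sub_self]
  have h1 : E = Eᴴ * E := sub_eq_zero.1 (conjTranspose_mul_self_eq_zero.1 h0)
  rw [h1, conjTranspose_mul, conjTranspose_conjTranspose]

/-- Descent on the range: an idempotent that is not primitive has a nonzero proper subidempotent,
whose range is strictly smaller. -/
theorem exists_isPrimitiveIdempotent {P : Matrix X X ℂ} (hP : P ∈ boseMesner S) (h0 : P ≠ 0)
    (hi : P * P = P) : ∃ E, IsPrimitiveIdempotent S E ∧ P * E = E := by
  induction hV : LinearMap.range (toLin' P) using WellFoundedLT.induction generalizing P with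
  | ind V ih =>
    by_cases hprim : IsPrimitiveIdempotent S P
    · exact ⟨P, hprim, hi⟩
    · obtain ⟨e, he, hee, heP, hPe, hne0, hneP⟩ : ∃ e ∈ boseMesner S, e * e = e ∧ e * P = e ∧
          P * e = e ∧ e ≠ 0 ∧ e ≠ P := by
        by_contra! hcon
        refine hprim ⟨hP, h0, hi, fun e he hee heP hPe => ?_⟩
        by_cases h : e = 0
        · exact Or.inl h
        · exact Or.inr (hcon e he hee heP hPe h)
      have hle : LinearMap.range (toLin' e) ≤ LinearMap.range (toLin' P) := by
        rw [← hPe, toLin'_mul]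
        exact LinearMap.range_comp_le_range _ _
      have hlt : LinearMap.range (toLin' e) < V := by
        rw [← hV]
        refine lt_of_le_of_ne hle fun heq => hneP ?_
        have : e * P = P := by
          apply toLin'.injective
          rw [toLin'_mul]
          ext1 v
          ext1
          have hv : toLin' P (Pi.single v 1) ∈ LinearMap.range (toLin' e) := heq ▸ ⟨_, rfl⟩
          obtain ⟨w, hw⟩ := hv
          simp only [LinearMap.comp_apply, LinearMap.single_apply]
          rw [← hw, ← LinearMap.comp_apply, ← toLin'_mul, hee]
        rw [← heP, this]
      obtain ⟨E, hE, hE'⟩ := ih _ hlt he hne0 hee rfl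
      exact ⟨E, hE, by rw [← hE', ← mul_assoc, hPe]⟩

/-- Lagrange interpolation on the spectrum writes the spectral projection as a polynomial in `M`, so
it stays in every algebra containing `M`. -/
theorem exists_aeval_eigenprojection {M : Matrix X X ℂ} (hM : M.IsHermitian) (i : X) :
    ∃ p : Polynomial ℂ, Polynomial.aeval M p * Polynomial.aeval M p = Polynomial.aeval M p ∧
      Polynomial.aeval M p ≠ 0 ∧
      M * Polynomial.aeval M p = (hM.eigenvalues i : ℂ) • Polynomial.aeval M p := by
  let l : X → ℂ := fun j => (hM.eigenvalues j : ℂ)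
  let φ := Unitary.conjStarAlgAut ℂ _ hM.eigenvectorUnitary
  have hMφ : M = φ (diagonal l) := hM.spectral_theorem
  let p := Lagrange.basis (Finset.univ.image l) id (l i)
  have hp : ∀ j, p.eval (l j) = if l j = l i then 1 else 0 := by
    intro j
    split_ifs with h
    · rw [h]
      exact Lagrange.eval_basis_self (v := id) Function.injective_id.injOn
        (Finset.mem_image_of_mem _ (Finset.mem_univ i))
    · exact Lagrange.eval_basis_of_ne (v := id) (Ne.symm h)
        (Finset.mem_image_of_mem _ (Finset.mem_univ j))
  have hP : Polynomial.aeval M p = φ (diagonal fun j => if l j = l i then 1 else 0) := by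
    have h1 : Polynomial.aeval (diagonal l) p = diagonal fun j => if l j = l i then 1 else 0 := by
      have := Polynomial.aeval_algHom_apply (diagonalAlgHom ℂ : (X → ℂ) →ₐ[ℂ] _) l p
      rw [diagonalAlgHom_apply, diagonalAlgHom_apply] at this
      rw [this, Polynomial.aeval_pi_apply]
      congr 1
      funext j
      rw [Polynomial.coe_aeval_eq_eval, hp]
    rw [← h1, hMφ]
    exact Polynomial.aeval_algHom_apply (φ : Matrix X X ℂ →ₐ[ℂ] Matrix X X ℂ) (diagonal l) p
  refine ⟨p, ?_, ?_, ?_⟩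
  · rw [hP, ← map_mul, diagonal_mul_diagonal]
    simp
  · rw [hP]
    intro h
    rw [map_eq_zero_iff φ φ.injective] at h
    have := congrFun (congrFun h i) i
    simp at this
  · rw [hP]
    conv_lhs => rw [hMφ]
    rw [← map_mul, diagonal_mul_diagonal, ← map_smul]
    congr 1
    ext a b
    by_cases hab : a = b
    · subst hab
      by_cases h : l a = l i
      · simp [h, l]
      · simp [h]
    · simp [hab]

/-- Below the projection onto an eigenspace of `M` lies a primitive idempotent `E`. There `E * M = λ
• E` with `0 < E.trace`, so the trace condition at `E` forces `0 ≤ λ`. -/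
theorem IsClassConstant.posSemidef_of_trace_nonneg (hS : IsSchurian S) (hs : IsSymmScheme S)
    {M : Matrix X X ℂ} (hM : IsClassConstant S M) (hH : M.IsHermitian)
    (h : ∀ E, IsPrimitiveIdempotent S E → 0 ≤ (E * M).trace) : M.PosSemidef := by
  rw [hH.posSemidef_iff_eigenvalues_nonneg]
  intro i
  obtain ⟨p, hidem, hne, heig⟩ := exists_aeval_eigenprojection hH i
  have hmem : Polynomial.aeval M p ∈ boseMesner S :=
    Algebra.adjoin_le (Set.singleton_subset_iff.2 hM.mem_boseMesner)
      (Polynomial.aeval_mem_adjoin_singleton ℂ M)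
  obtain ⟨E, hE, hPE⟩ := exists_isPrimitiveIdempotent hmem hne hidem
  have hEc := (mem_boseMesner_iff hS).1 hE.mem
  have hME : E * M = (hH.eigenvalues i : ℂ) • E := by
    rw [hEc.mul_comm hS hs hM, ← hPE, ← mul_assoc, heig, smul_mul_assoc]
  have hEE : Eᴴ * E = E := by
    rw [hEc.isHermitian_of_idempotent hS hs hE.mul_self, hE.mul_self]
  have htr : 0 < E.trace := by
    refine lt_of_le_of_ne ?_ ?_
    · rw [← hEE]
      exact (posSemidef_conjTranspose_mul_self E).trace_nonneg
    · intro h0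
      rw [← hEE, eq_comm, trace_conjTranspose_mul_self_eq_zero_iff] at h0
      exact hE.ne_zero h0
  have h1 := h E hE
  rw [hME, trace_smul, smul_eq_mul] at h1
  have h2 : (0 : ℂ) ≤ (hH.eigenvalues i : ℂ) :=
    le_of_mul_le_mul_right (by rwa [zero_mul]) htr
  exact_mod_cast h2

theorem IsPrimitiveIdempotent.trace_mul_nonneg (hS : IsSchurian S) (hs : IsSymmScheme S)
    {E : Matrix X X ℂ} (hE : IsPrimitiveIdempotent S E) {M : Matrix X X ℂ} (hM : M.PosSemidef) :
    0 ≤ (E * M).trace := by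
  have h := ((mem_boseMesner_iff hS).1 hE.mem).isHermitian_of_idempotent hS hs hE.mul_self
  have h1 := (hM.mul_mul_conjTranspose_same E).trace_nonneg
  rwa [h, trace_mul_comm, ← mul_assoc, hE.mul_self] at h1

end Schurian

end AssocScheme

namespace AssocScheme

/-! ### The Delsarte program as a semidefinite program, and existence of its maximum. -/

section DelsarteMatrix

set_option linter.unusedSectionVars false

open Matrix
open scoped ComplexOrder

variable {X : Type*} [Fintype X] [DecidableEq X]

/-- Nonnegative positive semidefinite matrices supported on the relations in `D`. -/
structure IsDelsarteMatrix (S : Setoid (X × X)) (D : Set (Quotient S)) (N : Matrix X X ℝ) :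
    Prop where
  posSemidef : (N.map (fun t : ℝ => (t : ℂ))).PosSemidef
  nonneg : ∀ x y, 0 ≤ N x y
  code : ∀ x y, Quotient.mk S (x, y) ∉ D → N x y = 0

variable {S : Setoid (X × X)} {D : Set (Quotient S)}

open Classical in
theorem sum_fiber_mul {N : Matrix X X ℝ} {a : Quotient S → ℝ}
    (ha : ∀ r, ∑ p : X × X with Quotient.mk S p = r, N p.1 p.2 = Fintype.card X * a r)
    (q : Quotient S → ℂ) :
    ∑ p : X × X, q (Quotient.mk S p) * (N p.1 p.2 : ℂ) = Fintype.card X * ∑ r, q r * (a r : ℂ) := by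
  rw [← Finset.sum_fiberwise Finset.univ (fun p : X × X => Quotient.mk S p), Finset.mul_sum]
  refine Finset.sum_congr rfl fun r _ => ?_
  have : ∑ p : X × X with Quotient.mk S p = r, q (Quotient.mk S p) * (N p.1 p.2 : ℂ) =
      ∑ p : X × X with Quotient.mk S p = r, q r * (N p.1 p.2 : ℂ) := by
    refine Finset.sum_congr rfl fun p hp => ?_
    rw [(Finset.mem_filter.1 hp).2]
  rw [this, ← Finset.mul_sum, ← Complex.ofReal_sum, ha r]
  push_cast
  ring

open Classical in
theorem sum_fiber_eq {N : Matrix X X ℝ} {a : Quotient S → ℝ}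
    (ha : ∀ r, ∑ p : X × X with Quotient.mk S p = r, N p.1 p.2 = Fintype.card X * a r) :
    ∑ x, ∑ y, N x y = Fintype.card X * ∑ r, a r := by
  rw [← Fintype.sum_prod_type' (f := fun x y => N x y),
    ← Finset.sum_fiberwise Finset.univ (fun p : X × X => Quotient.mk S p), Finset.mul_sum]
  exact Finset.sum_congr rfl fun r _ => ha r

open Classical in
theorem trace_mul_eq_sum_qFun (hs : IsSymmScheme S)
    {N : Matrix X X ℝ} {a : Quotient S → ℝ}
    (ha : ∀ r, ∑ p : X × X with Quotient.mk S p = r, N p.1 p.2 = Fintype.card X * a r)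
    {E : Matrix X X ℂ} (hE : IsClassConstant S E) :
    (E * N.map (fun t : ℝ => (t : ℂ))).trace =
      Fintype.card X * ∑ r, qFun S E r * (a r : ℂ) := by
  rw [← sum_fiber_mul ha, Fintype.sum_prod_type, Finset.sum_comm]
  simp only [trace, diag, Matrix.mul_apply, map_apply]
  refine Finset.sum_congr rfl fun x _ => Finset.sum_congr rfl fun y _ => ?_
  rw [hE.qFun_mk]
  congr 1
  exact hE (x, y) (y, x) (hs x y)

/-- The group of the scheme is transitive: all diagonal pairs are in one relation. -/
def IsHomogeneous (S : Setoid (X × X)) : Prop :=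
  ∀ x y : X, S (x, x) (y, y)

open Classical in
theorem sum_diag_fiber_eq_trace (hS : IsSchurian S) (hh : IsHomogeneous S) (x : X)
    (N : Matrix X X ℝ) :
    ∑ p : X × X with Quotient.mk S p = Quotient.mk S (x, x), N p.1 p.2 = N.trace := by
  have h : (Finset.univ.filter fun p : X × X => Quotient.mk S p = Quotient.mk S (x, x)) =
      Finset.univ.image fun y : X => (y, y) := by
    ext ⟨y, z⟩
    simp only [Finset.mem_filter, Finset.mem_univ, true_and, Finset.mem_image, Prod.mk.injEq]
    constructor
    · intro h
      exact ⟨y, rfl, hS.mk_diag_iff x (y, z) (Quotient.exact h.symm)⟩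
    · rintro ⟨w, rfl, rfl⟩
      exact Quotient.sound (hh _ _)
  rw [h, Finset.sum_image fun a _ b _ hab => (Prod.mk.inj hab).1]
  rfl

open Classical in
-- Only the sums of `N` over the classes enter, so `N` itself need not be class-constant. This
-- matters for blocks and block sums of an optimal matrix.
theorem IsDelsarteMatrix.mem_delsarteObjectives [Nonempty X] (hS : IsSchurian S)
    (hs : IsSymmScheme S) (hh : IsHomogeneous S) {N : Matrix X X ℝ}
    (hN : IsDelsarteMatrix S D N) (ht : N.trace = Fintype.card X) :
    (∑ x, ∑ y, N x y) / Fintype.card X ∈ delsarteObjectives S D := by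
  have hX : (0 : ℝ) < Fintype.card X := by exact_mod_cast Fintype.card_pos
  let a : Quotient S → ℝ := fun r =>
    (∑ p : X × X with Quotient.mk S p = r, N p.1 p.2) / Fintype.card X
  have ha : ∀ r, ∑ p : X × X with Quotient.mk S p = r, N p.1 p.2 = Fintype.card X * a r :=
    fun r => (mul_div_cancel₀ _ hX.ne').symm
  refine ⟨a, ⟨fun x => ?_, fun r hr => ?_, fun E hE => ?_, fun r => ?_⟩, ?_⟩
  · simp only [a]
    rw [sum_diag_fiber_eq_trace hS hh, ht, div_self hX.ne']
  · simp only [a]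
    rw [Finset.sum_eq_zero, zero_div]
    intro p hp
    exact hN.code _ _ (by rwa [(Finset.mem_filter.1 hp).2])
  · have h1 := hE.trace_mul_nonneg hS hs hN.posSemidef
    rw [trace_mul_eq_sum_qFun hs ha ((mem_boseMesner_iff hS).1 hE.mem)] at h1
    have h2 : (0 : ℂ) ≤ ∑ r, qFun S E r * (a r : ℂ) :=
      le_of_mul_le_mul_left (by rwa [mul_zero]) (show (0 : ℂ) < Fintype.card X by exact_mod_cast hX)
    obtain ⟨h3, h4⟩ := Complex.le_def.1 h2
    exact ⟨_, h3, Complex.ext rfl h4.symm⟩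
  · exact div_nonneg (Finset.sum_nonneg fun p _ => hN.nonneg _ _) hX.le
  · rw [sum_fiber_eq ha, mul_div_cancel_left₀ _ hX.ne']

open Classical in
theorem DelsarteFeasible.exists_isDelsarteMatrix [Nonempty X] (hS : IsSchurian S)
    (hs : IsSymmScheme S) (hh : IsHomogeneous S) {a : Quotient S → ℝ}
    (ha : DelsarteFeasible S D a) :
    ∃ N : Matrix X X ℝ, IsDelsarteMatrix S D N ∧ (∀ x, N x x = 1) ∧
      ∑ x, ∑ y, N x y = Fintype.card X * ∑ r, a r := by
  have hX : (0 : ℝ) < Fintype.card X := by exact_mod_cast Fintype.card_pos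
  let c : Quotient S → ℝ := fun r => ∑ p : X × X with Quotient.mk S p = r, 1
  have hc : ∀ r, 0 < c r := by
    intro r
    induction r using Quotient.inductionOn with
    | h p => exact Finset.sum_pos (fun _ _ => one_pos) ⟨p, by simp⟩
  -- The mass `|X| a r` is spread evenly over the `c r` pairs of the class `r`.
  let N : Matrix X X ℝ := of fun x y =>
    Fintype.card X * a (Quotient.mk S (x, y)) / c (Quotient.mk S (x, y))
  have hsum : ∀ r, ∑ p : X × X with Quotient.mk S p = r, N p.1 p.2 = Fintype.card X * a r := by
    intro r
    have : ∑ p : X × X with Quotient.mk S p = r, N p.1 p.2 =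
        ∑ p : X × X with Quotient.mk S p = r, (Fintype.card X * a r / c r) * 1 := by
      refine Finset.sum_congr rfl fun p hp => ?_
      have hp' : Quotient.mk S (p.1, p.2) = r := (Finset.mem_filter.1 hp).2
      simp only [N, of_apply, hp', mul_one]
    rw [this, ← Finset.mul_sum]
    exact div_mul_cancel₀ _ (hc r).ne'
  have hcc : IsClassConstant S (N.map (fun t : ℝ => (t : ℂ))) := by
    intro p q hpq
    have h : Quotient.mk S (p.1, p.2) = Quotient.mk S (q.1, q.2) := Quotient.sound hpq
    simp only [map_apply, N, of_apply, h]
  refine ⟨N, ⟨?_, fun x y => ?_, fun x y h => ?_⟩, fun x => ?_, sum_fiber_eq hsum⟩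
  · refine hcc.posSemidef_of_trace_nonneg hS hs ?_ fun E hE => ?_
    · rw [IsHermitian, ← hcc.transpose_eq hs, conjTranspose, transpose_transpose]
      ext x y
      have h := congrFun (congrFun (hcc.transpose_eq hs) x) y
      simpa [eq_comm] using h
    · obtain ⟨t, ht, hte⟩ := ha.macWilliams E hE
      rw [trace_mul_eq_sum_qFun hs hsum ((mem_boseMesner_iff hS).1 hE.mem), hte]
      exact_mod_cast mul_nonneg hX.le ht
  · exact div_nonneg (mul_nonneg hX.le (ha.nonneg _)) (hc _).le
  · simp only [N, of_apply, ha.code _ h, mul_zero, zero_div]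
  · have h1 : c (Quotient.mk S (x, x)) = Fintype.card X := by
      have := sum_diag_fiber_eq_trace hS hh x (of fun _ _ : X => (1 : ℝ))
      simpa [trace, c] using this
    simp only [N, of_apply, ha.normalization x, h1, mul_one]
    exact div_self hX.ne'

theorem IsDelsarteMatrix.le_one {N : Matrix X X ℝ} (hN : IsDelsarteMatrix S D N)
    (h1 : ∀ x, N x x = 1) (x y : X) : N x y ≤ 1 := by
  rcases eq_or_ne x y with rfl | hxy
  · exact (h1 x).le
  have hsym : N y x = N x y := by
    have := congrFun (congrFun hN.posSemidef.1 x) y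
    simpa using this
  -- The quadratic form at `e_x - e_y` is `2 - 2 * N x y`.
  have h := hN.posSemidef.dotProduct_mulVec_nonneg (Pi.single x 1 - Pi.single y 1)
  have h2 : (0 : ℂ) ≤ ((1 - N x y - (N x y - 1) : ℝ) : ℂ) := by
    simpa [sub_dotProduct, mulVec_sub, h1, hsym, Pi.star_def, Pi.single_apply, dotProduct_sub,
      apply_ite star, dotProduct, sub_mul, Finset.sum_sub_distrib] using h
  have h3 : (0 : ℝ) ≤ 1 - N x y - (N x y - 1) := by exact_mod_cast h2
  linarith

theorem isDelsarteMatrix_one (hD : ∀ x, Quotient.mk S (x, x) ∈ D) :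
    IsDelsarteMatrix S D (1 : Matrix X X ℝ) where
  posSemidef := by
    rw [Matrix.map_one _ Complex.ofReal_zero Complex.ofReal_one]
    exact PosSemidef.one
  nonneg x y := by
    rw [Matrix.one_apply]
    split_ifs <;> norm_num
  code x y h := by
    refine Matrix.one_apply_ne ?_
    rintro rfl
    exact h (hD x)

open Classical in
theorem isClosed_setOf_delsarteFeasible : IsClosed {a | DelsarteFeasible S D a} := by
  have : {a | DelsarteFeasible S D a} =
      (⋂ x : X, {a | a (Quotient.mk S (x, x)) = 1}) ∩ (⋂ r, ⋂ _ : r ∉ D, {a | a r = 0}) ∩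
      (⋂ E, ⋂ _ : IsPrimitiveIdempotent S E,
        {a | (0 : ℂ) ≤ ∑ r, qFun S E r * (a r : ℂ)}) ∩ ⋂ r, {a | 0 ≤ a r} := by
    ext a
    simp only [Set.mem_inter_iff, Set.mem_iInter, Set.mem_ofPred_eq]
    constructor
    · intro h
      refine ⟨⟨⟨h.normalization, h.code⟩, fun E hE => ?_⟩, h.nonneg⟩
      obtain ⟨t, ht, hte⟩ := h.macWilliams E hE
      rw [hte]
      exact_mod_cast ht
    · rintro ⟨⟨⟨h1, h2⟩, h3⟩, h4⟩
      refine ⟨h1, h2, fun E hE => ?_, h4⟩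
      obtain ⟨h5, h6⟩ := Complex.le_def.1 (h3 E hE)
      exact ⟨_, h5, Complex.ext rfl h6.symm⟩
  rw [this]
  refine IsClosed.inter (IsClosed.inter (IsClosed.inter ?_ ?_) ?_) ?_
  · exact isClosed_iInter fun x => isClosed_eq (continuous_apply _) continuous_const
  · exact isClosed_iInter fun r => isClosed_iInter fun _ =>
      isClosed_eq (continuous_apply _) continuous_const
  · refine isClosed_iInter fun E => isClosed_iInter fun _ => isClosed_le continuous_const ?_
    fun_prop
  · exact isClosed_iInter fun r => isClosed_le continuous_const (continuous_apply _)

open Classical in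
theorem DelsarteFeasible.sum_le [Nonempty X] (hS : IsSchurian S) (hs : IsSymmScheme S)
    (hh : IsHomogeneous S) {a : Quotient S → ℝ} (ha : DelsarteFeasible S D a) :
    ∑ r, a r ≤ Fintype.card X := by
  have hX : (0 : ℝ) < Fintype.card X := by exact_mod_cast Fintype.card_pos
  obtain ⟨N, hN, h1, h2⟩ := ha.exists_isDelsarteMatrix hS hs hh
  have h3 : ∑ x, ∑ y, N x y ≤ ∑ _x : X, ∑ _y : X, (1 : ℝ) :=
    Finset.sum_le_sum fun x _ => Finset.sum_le_sum fun y _ => hN.le_one h1 x y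
  rw [h2] at h3
  simp only [Finset.sum_const, Finset.card_univ, nsmul_eq_mul, mul_one] at h3
  exact le_of_mul_le_mul_left h3 hX

open Classical in
/-- The maximum of the Delsarte linear program exists. -/
theorem isGreatest_delsarteVal [Nonempty X] (hS : IsSchurian S) (hs : IsSymmScheme S)
    (hh : IsHomogeneous S) (hD : ∀ x, Quotient.mk S (x, x) ∈ D) :
    IsGreatest (delsarteObjectives S D) (delsarteVal S D) := by
  have hne : (delsarteObjectives S D).Nonempty :=
    ⟨_, (isDelsarteMatrix_one hD).mem_delsarteObjectives hS hs hh (by simp)⟩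
  have himg : delsarteObjectives S D =
      (fun a : Quotient S → ℝ => ∑ r, a r) '' {a | DelsarteFeasible S D a} := by
    ext v
    exact ⟨fun ⟨a, ha, hv⟩ => ⟨a, ha, hv.symm⟩, fun ⟨a, ha, hv⟩ => ⟨a, ha, hv.symm⟩⟩
  -- The variables are nonnegative with sum at most `|X|`, so the closed feasible set lies in a box.
  have hcomp : IsCompact {a | DelsarteFeasible S D a} := by
    refine (isCompact_Icc (a := (0 : Quotient S → ℝ))
      (b := fun _ => (Fintype.card X : ℝ))).of_isClosed_subset
      isClosed_setOf_delsarteFeasible fun a ha => ⟨ha.nonneg, fun r => ?_⟩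
    exact (Finset.single_le_sum (fun r _ => ha.nonneg r) (Finset.mem_univ r)).trans
      (ha.sum_le hS hs hh)
  have hK : IsCompact (delsarteObjectives S D) := by
    rw [himg]
    exact hcomp.image (continuous_finsetSum _ fun r _ => continuous_apply r)
  exact hK.isGreatest_sSup hne

theorem one_le_delsarteVal [Nonempty X] (hS : IsSchurian S) (hs : IsSymmScheme S)
    (hh : IsHomogeneous S) (hD : ∀ x, Quotient.mk S (x, x) ∈ D) : 1 ≤ delsarteVal S D := by
  have hX : (0 : ℝ) < Fintype.card X := by exact_mod_cast Fintype.card_pos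
  have h := (isGreatest_delsarteVal hS hs hh hD).2
    ((isDelsarteMatrix_one hD).mem_delsarteObjectives hS hs hh (by simp))
  simpa [Matrix.one_apply, hX.ne'] using h

/-- The bound on the entry sum without normalization of the trace. -/
theorem IsDelsarteMatrix.sum_le [Nonempty X] (hS : IsSchurian S)
    (hs : IsSymmScheme S) (hh : IsHomogeneous S) (hD : ∀ x, Quotient.mk S (x, x) ∈ D)
    {N : Matrix X X ℝ} (hN : IsDelsarteMatrix S D N) (ht : 0 < N.trace) :
    ∑ x, ∑ y, N x y ≤ N.trace * delsarteVal S D := by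
  have hX : (0 : ℝ) < Fintype.card X := by exact_mod_cast Fintype.card_pos
  have hc : 0 < (Fintype.card X : ℝ) / N.trace := div_pos hX ht
  -- Rescaling to trace `|X|` makes the matrix a witness for the program.
  have hN' : IsDelsarteMatrix S D (((Fintype.card X : ℝ) / N.trace) • N) := by
    refine ⟨?_, fun x y => mul_nonneg hc.le (hN.nonneg x y), fun x y h => ?_⟩
    · have : (((Fintype.card X : ℝ) / N.trace) • N).map (fun t : ℝ => (t : ℂ)) =
          (((Fintype.card X : ℝ) / N.trace : ℝ) : ℂ) • N.map (fun t : ℝ => (t : ℂ)) := by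
        ext x y
        simp
      rw [this]
      exact hN.posSemidef.smul (by exact_mod_cast hc.le)
    · rw [Matrix.smul_apply, hN.code x y h, smul_zero]
  have h := (isGreatest_delsarteVal hS hs hh hD).2 (hN'.mem_delsarteObjectives hS hs hh (by
    rw [trace_smul, smul_eq_mul, div_mul_cancel₀ _ ht.ne']))
  simp only [Matrix.smul_apply, smul_eq_mul, ← Finset.mul_sum] at h
  rwa [div_mul_eq_mul_div, div_right_comm, mul_div_cancel_left₀ _ hX.ne', div_le_iff₀' ht] at h

end DelsarteMatrix

end AssocScheme

namespace AssocScheme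

/-! ### Submultiplicativity over a product of point sets. -/

section Product

open Matrix
open scoped ComplexOrder

set_option linter.unusedSectionVars false

variable {X₁ X₂ X : Type*} [Fintype X₁] [DecidableEq X₁] [Nonempty X₁] [Fintype X₂]
  [DecidableEq X₂] [Nonempty X₂] [Fintype X] [DecidableEq X]

/-- Summing a positive semidefinite matrix over the second coordinates. -/
theorem posSemidef_sum_snd {N : Matrix (X₁ × X₂) (X₁ × X₂) ℂ} (hN : N.PosSemidef) :
    (of fun x x' : X₁ => ∑ y, ∑ y', N (x, y) (x', y')).PosSemidef := by
  -- `Q` is the incidence matrix of the projection to `X₁`, and conjugation by it sums over fibres.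
  let Q : Matrix (X₁ × X₂) X₁ ℂ := of fun p x => if p.1 = x then 1 else 0
  have : (of fun x x' : X₁ => ∑ y, ∑ y', N (x, y) (x', y')) = Qᴴ * N * Q := by
    ext x x'
    simp only [of_apply, Matrix.mul_apply, conjTranspose_apply, Q, Fintype.sum_prod_type,
      apply_ite star, star_one, star_zero, ite_mul, one_mul, zero_mul, mul_ite, mul_one, mul_zero]
    rw [Finset.sum_eq_single x']
    · rw [Finset.sum_comm]
      refine Finset.sum_congr rfl fun y' _ => ?_
      rw [if_pos rfl, Finset.sum_eq_single x]
      · simp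
      · intro b _ hb
        simp [hb]
      · simp
    · intro b _ hb
      simp [hb]
    · simp
  rw [this]
  exact hN.conjTranspose_mul_mul_same Q

/-- The Delsarte bound is submultiplicative. -/
theorem delsarteVal_le_mul {S₁ : Setoid (X₁ × X₁)} {S₂ : Setoid (X₂ × X₂)} {S : Setoid (X × X)}
    {D₁ : Set (Quotient S₁)} {D₂ : Set (Quotient S₂)} {D : Set (Quotient S)} (e : X₁ × X₂ ≃ X)
    (hS₁ : IsSchurian S₁) (hs₁ : IsSymmScheme S₁) (hh₁ : IsHomogeneous S₁)
    (hD₁ : ∀ x, Quotient.mk S₁ (x, x) ∈ D₁)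
    (hS₂ : IsSchurian S₂) (hs₂ : IsSymmScheme S₂) (hh₂ : IsHomogeneous S₂)
    (hD₂ : ∀ x, Quotient.mk S₂ (x, x) ∈ D₂)
    (hS : IsSchurian S) (hs : IsSymmScheme S) (hh : IsHomogeneous S)
    (hD : ∀ x, Quotient.mk S (x, x) ∈ D)
    (h₁ : ∀ p q : X₁ × X₂, Quotient.mk S (e p, e q) ∈ D → Quotient.mk S₁ (p.1, q.1) ∈ D₁)
    (h₂ : ∀ p q : X₁ × X₂, Quotient.mk S (e p, e q) ∈ D → Quotient.mk S₂ (p.2, q.2) ∈ D₂) :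
    delsarteVal S D ≤ delsarteVal S₁ D₁ * delsarteVal S₂ D₂ := by
  have : Nonempty X := e.nonempty_congr.1 inferInstance
  obtain ⟨⟨a, ha, hv⟩, -⟩ := isGreatest_delsarteVal hS hs hh hD
  obtain ⟨N, hN, hdiag, hsum⟩ := ha.exists_isDelsarteMatrix hS hs hh
  have hX₁ : (0 : ℝ) < Fintype.card X₁ := by exact_mod_cast Fintype.card_pos
  have hX₂ : (0 : ℝ) < Fintype.card X₂ := by exact_mod_cast Fintype.card_pos
  have hfib : ∀ x : X₁, ∑ y, ∑ y', N (e (x, y)) (e (x, y')) ≤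
      Fintype.card X₂ * delsarteVal S₂ D₂ := by
    intro x
    have hB : IsDelsarteMatrix S₂ D₂ (N.submatrix (fun y => e (x, y)) fun y => e (x, y)) := by
      refine ⟨?_, fun _ _ => hN.nonneg _ _, fun y y' h => hN.code _ _ fun h' => h (h₂ _ _ h')⟩
      rw [← submatrix_map]
      exact hN.posSemidef.submatrix _
    have ht : (N.submatrix (fun y => e (x, y)) fun y => e (x, y)).trace = Fintype.card X₂ := by
      simp [trace, hdiag]
    have := hB.sum_le hS₂ hs₂ hh₂ hD₂ (by rw [ht]; exact hX₂)
    rwa [ht] at this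
  let C : Matrix X₁ X₁ ℝ := of fun x x' => ∑ y, ∑ y', N (e (x, y)) (e (x', y'))
  have hC : IsDelsarteMatrix S₁ D₁ C := by
    refine ⟨?_, fun x x' => ?_, fun x x' h => ?_⟩
    · have := posSemidef_sum_snd (hN.posSemidef.submatrix e)
      convert this using 1
      ext x x'
      simp [C]
    · exact Finset.sum_nonneg fun _ _ => Finset.sum_nonneg fun _ _ => hN.nonneg _ _
    · exact Finset.sum_eq_zero fun y _ => Finset.sum_eq_zero fun y' _ =>
        hN.code _ _ fun h' => h (h₁ _ _ h')
  have htC : C.trace ≤ Fintype.card X₁ * (Fintype.card X₂ * delsarteVal S₂ D₂) := by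
    rw [← nsmul_eq_mul, ← Finset.card_univ, ← Finset.sum_const]
    exact Finset.sum_le_sum fun x _ => hfib x
  have htC' : 0 < C.trace := by
    refine Finset.sum_pos (fun x _ => ?_) Finset.univ_nonempty
    refine Finset.sum_pos (fun y _ => ?_) Finset.univ_nonempty
    refine lt_of_lt_of_le one_pos ?_
    rw [← hdiag (e (x, y))]
    exact Finset.single_le_sum (f := fun y' => N (e (x, y)) (e (x, y')))
      (fun y' _ => hN.nonneg _ _) (Finset.mem_univ y)
  have hsC : ∑ x, ∑ x', C x x' = ∑ z, ∑ z', N z z' := by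
    rw [← e.sum_comp, Fintype.sum_prod_type]
    refine Finset.sum_congr rfl fun x _ => ?_
    simp only [C, of_apply]
    rw [Finset.sum_comm]
    refine Finset.sum_congr rfl fun y _ => ?_
    rw [← e.sum_comp, Fintype.sum_prod_type]
  have hmain := hC.sum_le hS₁ hs₁ hh₁ hD₁ htC'
  have hv₁ : 0 ≤ delsarteVal S₁ D₁ := zero_le_one.trans (one_le_delsarteVal hS₁ hs₁ hh₁ hD₁)
  have hcard : (Fintype.card X : ℝ) = Fintype.card X₁ * Fintype.card X₂ := by
    rw [← Fintype.card_congr e, Fintype.card_prod, Nat.cast_mul]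
  rw [hsC, hsum, ← hv, hcard] at hmain
  have := hmain.trans (mul_le_mul_of_nonneg_right htC hv₁)
  refine le_of_mul_le_mul_left (this.trans_eq ?_) (mul_pos hX₁ hX₂)
  ring

end Product

/-! ### The refined powers of the Hamming scheme satisfy the hypotheses. -/

section Hamming

set_option linter.unusedSectionVars false

variable {F : Type*} [Field F] [Fintype F] [DecidableEq F] {n d l : ℕ}

theorem translationMap_eq_iff (v w : Fin n → F) :
    translationMap (weakHamming F n) v = translationMap (weakHamming F n) w ↔
      hammingNorm v = hammingNorm w := by
  rw [translationMap, translationMap, Quotient.eq]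
  change hammingDist v 0 = hammingDist w 0 ↔ _
  rw [hammingDist_zero_right, hammingDist_zero_right]

theorem translationMap_mem_distanceCode_iff (v : Fin n → F) :
    translationMap (weakHamming F n) v ∈ distanceCode F n d ↔
      hammingNorm v = 0 ∨ d ≤ hammingNorm v := by
  constructor
  · rintro ⟨x, y, h, hd⟩
    rw [translationMap, Quotient.eq] at h
    change hammingDist v 0 = hammingDist x y at h
    rwa [← hammingDist_zero_right, h]
  · intro h
    exact ⟨v, 0, rfl, by rwa [hammingDist_zero_right]⟩

theorem refinedPower_rel_iff (p q : (Fin l → Fin n → F) × (Fin l → Fin n → F)) :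
    refinedPower (weakHamming F n) (Set.univ : Set (Fin l → F)) p q ↔
      ∀ k : Fin l → F, hammingNorm (∑ i, k i • (p.1 - p.2) i) =
        hammingNorm (∑ i, k i • (q.1 - q.2) i) := by
  rw [refinedPower, Setoid.ker_def, funext_iff]
  simp only [configuration, translationMap_eq_iff, Subtype.forall, Set.mem_univ, forall_const]

theorem mk_mem_refinedCode_iff (x y : Fin l → Fin n → F) :
    Quotient.mk (refinedPower (weakHamming F n) (Set.univ : Set (Fin l → F))) (x, y) ∈
        refinedCode (weakHamming F n) (Set.univ : Set (Fin l → F)) (distanceCode F n d) ↔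
      ∀ k : Fin l → F, hammingNorm (∑ i, k i • (x - y) i) = 0 ∨
        d ≤ hammingNorm (∑ i, k i • (x - y) i) := by
  constructor
  · rintro ⟨x', y', h, hd⟩ k
    rw [Quotient.eq, refinedPower_rel_iff] at h
    rw [h k]
    exact (translationMap_mem_distanceCode_iff _).1 (hd ⟨k, Set.mem_univ k⟩)
  · intro h
    exact ⟨x, y, rfl, fun k => (translationMap_mem_distanceCode_iff _).2 (h k)⟩

theorem isSymmScheme_refinedPower :
    IsSymmScheme (refinedPower (weakHamming F n) (Set.univ : Set (Fin l → F))) := by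
  intro x y
  rw [refinedPower_rel_iff]
  intro k
  have : ∑ i, k i • (y - x) i = -∑ i, k i • (x - y) i := by
    rw [← Finset.sum_neg_distrib]
    refine Finset.sum_congr rfl fun i _ => ?_
    rw [← smul_neg, ← Pi.neg_apply, neg_sub]
  show hammingNorm (∑ i, k i • (x - y) i) = hammingNorm (∑ i, k i • (y - x) i)
  rw [this]
  simp [hammingNorm]

theorem isHomogeneous_refinedPower :
    IsHomogeneous (refinedPower (weakHamming F n) (Set.univ : Set (Fin l → F))) := by
  intro x y
  rw [refinedPower_rel_iff]
  simp

theorem mk_self_mem_refinedCode (x : Fin l → Fin n → F) :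
    Quotient.mk (refinedPower (weakHamming F n) (Set.univ : Set (Fin l → F))) (x, x) ∈
      refinedCode (weakHamming F n) (Set.univ : Set (Fin l → F)) (distanceCode F n d) := by
  rw [mk_mem_refinedCode_iff]
  simp

/-- The action of a monomial transformation on tuples of words. -/
def monomialEquiv (σ : Equiv.Perm (Fin n)) (u : Fin n → Fˣ) :
    (Fin l → Fin n → F) ≃ (Fin l → Fin n → F) where
  toFun x i j := u j * x i (σ j)
  invFun x i j := (u (σ.symm j))⁻¹ * x i (σ.symm j)
  left_inv x := by
    ext i j
    simp
  right_inv x := by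
    ext i j
    simp

theorem hammingNorm_sum_monomialEquiv (σ : Equiv.Perm (Fin n)) (u : Fin n → Fˣ)
    (x : Fin l → Fin n → F) (k : Fin l → F) :
    hammingNorm (∑ i, k i • monomialEquiv σ u x i) = hammingNorm (∑ i, k i • x i) := by
  have h : ∀ j, (∑ i, k i • monomialEquiv σ u x i) j = u j * (∑ i, k i • x i) (σ j) := by
    intro j
    simp only [Finset.sum_apply, Pi.smul_apply, smul_eq_mul, monomialEquiv, Equiv.coe_fn_mk,
      Finset.mul_sum]
    exact Finset.sum_congr rfl fun i _ => by ring
  simp only [hammingNorm, h]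
  refine Finset.card_bij (fun j _ => σ j) ?_ (fun _ _ _ _ h => σ.injective h) ?_
  · intro j hj
    simpa using hj
  · intro j hj
    exact ⟨σ.symm j, by simpa using hj, by simp⟩

/-- Each of the `n` columns of a tuple is a functional on `F^l`, and the configuration at `k` counts
the columns not vanishing at `k`. The extension theorem then matches columns up to permutation and
unit scalars. -/
theorem exists_monomialEquiv_eq (v w : Fin l → Fin n → F)
    (h : ∀ k : Fin l → F, hammingNorm (∑ i, k i • v i) = hammingNorm (∑ i, k i • w i)) :
    ∃ (σ : Equiv.Perm (Fin n)) (u : Fin n → Fˣ), monomialEquiv σ u v = w := by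
  let f : (Fin l → Fin n → F) → Fin n → Module.Dual F (Fin l → F) := fun x j =>
    ∑ i, x i j • LinearMap.proj i
  have hf : ∀ x j k, f x j k = (∑ i, k i • x i) j := by
    intro x j k
    simp only [f, LinearMap.sum_apply, LinearMap.smul_apply, LinearMap.proj_apply, smul_eq_mul,
      Finset.sum_apply, Pi.smul_apply, mul_comm]
  have hnorm : ∀ x k, Nat.card {j // f x j k ≠ 0} = hammingNorm (∑ i, k i • x i) := by
    intro x k
    rw [Nat.card_eq_fintype_card, Fintype.card_subtype]
    simp only [hf, hammingNorm]
  obtain ⟨σ, u, hσ⟩ := exists_perm_units_of_card_ne_zero_eq (f v) (f w) fun k => by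
    rw [hnorm, hnorm, h]
  refine ⟨σ, u, ?_⟩
  ext i j
  have := LinearMap.congr_fun (hσ j) (Pi.single i 1)
  rw [hf, Units.smul_def, LinearMap.smul_apply, hf] at this
  simpa [monomialEquiv, Pi.single_apply, ite_apply] using this.symm

theorem isSchurian_refinedPower :
    IsSchurian (refinedPower (weakHamming F n) (Set.univ : Set (Fin l → F))) := by
  intro p q hpq
  rw [refinedPower_rel_iff] at hpq
  obtain ⟨σ, u, h⟩ := exists_monomialEquiv_eq (p.1 - p.2) (q.1 - q.2) hpq
  have hsub : ∀ x y : Fin l → Fin n → F,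
      monomialEquiv σ u (x - y) = monomialEquiv σ u x - monomialEquiv σ u y := by
    intro x y
    ext i j
    simp [monomialEquiv, mul_sub]
  -- Translate `p.2` to the origin, apply the monomial map taking `p.1 - p.2` to `q.1 - q.2`, and
  -- translate the origin to `q.2`.
  refine ⟨(Equiv.subRight p.2).trans ((monomialEquiv σ u).trans (Equiv.addRight q.2)),
    ?_, ?_, fun a b => ?_⟩
  · simp [h]
  · have h0 := hsub 0 0
    rw [sub_self, sub_self] at h0
    simp only [Equiv.trans_apply, Equiv.subRight_apply, Equiv.coe_addRight, sub_self, h0, zero_add]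
  · rw [refinedPower_rel_iff]
    intro k
    simp only [Equiv.trans_apply, Equiv.subRight_apply, Equiv.coe_addRight, add_sub_add_right_eq_sub,
      ← hsub, sub_sub_sub_cancel_right]
    exact hammingNorm_sum_monomialEquiv σ u (a - b) k

theorem isGreatest_krawtchoukLinVal (n d l : ℕ) :
    IsGreatest (krawtchoukLinObjectives F n d l) (krawtchoukLinVal F n d l) :=
  isGreatest_delsarteVal isSchurian_refinedPower isSymmScheme_refinedPower
    isHomogeneous_refinedPower mk_self_mem_refinedCode

theorem one_le_krawtchoukLinVal (n d l : ℕ) : 1 ≤ krawtchoukLinVal F n d l :=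
  one_le_delsarteVal isSchurian_refinedPower isSymmScheme_refinedPower
    isHomogeneous_refinedPower mk_self_mem_refinedCode

theorem krawtchoukLinVal_add_le (n d l₁ l₂ : ℕ) :
    krawtchoukLinVal F n d (l₁ + l₂) ≤ krawtchoukLinVal F n d l₁ * krawtchoukLinVal F n d l₂ := by
  refine delsarteVal_le_mul (Fin.appendEquiv l₁ l₂)
    isSchurian_refinedPower isSymmScheme_refinedPower isHomogeneous_refinedPower
    mk_self_mem_refinedCode
    isSchurian_refinedPower isSymmScheme_refinedPower isHomogeneous_refinedPower
    mk_self_mem_refinedCode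
    isSchurian_refinedPower isSymmScheme_refinedPower isHomogeneous_refinedPower
    mk_self_mem_refinedCode (fun p q h => ?_) fun p q h => ?_
  · rw [mk_mem_refinedCode_iff] at h ⊢
    intro k
    -- Coefficients padded with zeros see only the first `l₁` words, so the distance condition
    -- passes to the factor.
    have := h (Fin.append k 0)
    simpa [Fin.sum_univ_add, Fin.appendEquiv] using this
  · rw [mk_mem_refinedCode_iff] at h ⊢
    intro k
    have := h (Fin.append 0 k)
    simpa [Fin.sum_univ_add, Fin.appendEquiv] using this

end Hamming

end AssocScheme

theorem mainTheorem11 (F : Type*) [Field F] [Fintype F] [DecidableEq F] (n d l₁ l₂ : ℕ)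
    (hn : 0 < n) (hd : d ≤ n) (hl₁ : 0 < l₁) (hl₂ : 0 < l₂) :
    (∀ l : ℕ, 0 < l → IsGreatest (AssocScheme.krawtchoukLinObjectives F n d l)
      (AssocScheme.krawtchoukLinVal F n d l)) ∧
    AssocScheme.krawtchoukLinVal F n d (l₁ + l₂) ≤
      AssocScheme.krawtchoukLinVal F n d l₁ * AssocScheme.krawtchoukLinVal F n d l₂ ∧
    Real.log (AssocScheme.krawtchoukLinVal F n d (l₁ + l₂)) ≤
      Real.log (AssocScheme.krawtchoukLinVal F n d l₁) +
        Real.log (AssocScheme.krawtchoukLinVal F n d l₂) := by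
  have hpos : ∀ l, 0 < AssocScheme.krawtchoukLinVal F n d l := fun l =>
    one_pos.trans_le (AssocScheme.one_le_krawtchoukLinVal n d l)
  have hmul := AssocScheme.krawtchoukLinVal_add_le (F := F) n d l₁ l₂
  refine ⟨fun l _ => AssocScheme.isGreatest_krawtchoukLinVal n d l, hmul, ?_⟩
  rw [← Real.log_mul (hpos l₁).ne' (hpos l₂).ne']
  exact Real.log_le_log (hpos _) hmul
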